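/- For integers $n\ge 1$, $1\le m\le n$ and $0\le i<j\le n$ let $S_{\{i,j\}_n^m}$ denote the multiset obtained from $\{0,1,\ldots,m-1,m,m,m+1,\ldots,n\}$ (each of $0,\ldots,n$ once, except that $m$ occurs twice) by deleting all occurrences of $i$ and of $j$. It is called Laplacian realizable if there is a connected simple graph on $n$ vertices whose Laplacian matrix $D-A$ has exactly this multiset as its eigenvalues, counted with multiplicity. Let $n\ge 6$ and let $0\le i<j<n$ be integers. Then: (i) if $n\equiv 0 \pmod 4$, then $S_{\{i,j\}_n^1}$ is Laplacian realizable if and only if $j=n-1$ and $i=2k$ for some integer $k$ with $1\le k\le \frac{n-2}{2}$; (ii) if $n\equiv 1 \pmod 4$, then $S_{\{i,j\}_n^1}$ is Laplacian realizable if and only if $j=n-1$ and $i=2k$ for some integer $k$ with $1\le k\le \frac{n-3}{2}$; (iii) if $n\equiv 2 \pmod 4$, then $S_{\{i,j\}_n^1}$ is Laplacian realizable if and only if $j=n-1$ and $i=2k+1$ for some integer $k$ with $1\le k\le \frac{n-4}{2}$; (iv) if $n\equiv 3 \pmod 4$, then $S_{\{i,j\}_n^1}$ is Laplacian realizable if and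 only if $j=n-1$ and $i=2k+1$ for some integer $k$ with $1\le k\le \frac{n-3}{2}$. -/

import Mathlib

/-- The Laplacian spectrum of a finite simple graph: the multiset of eigenvalues of its Laplacian
matrix `D - A`, each repeated according to its multiplicity. -/
noncomputable def laplacianSpectrum {V : Type*} [Fintype V] [DecidableEq V]
    (G : SimpleGraph V) [DecidableRel G.Adj] : Multiset ℝ :=
  (G.lapMatrix ℝ).charpoly.roots

/-- The multiset `S_{{i,j}_n^m} = {0, 1, …, m-1, m, m, m+1, …, n} ∖ {i, j}`: the numbers
`0, …, n` with `m` doubled, from which all occurrences of `i` and of `j` are deleted. -/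
def specSet (n m i j : ℕ) : Multiset ℕ :=
  (m ::ₘ Multiset.range (n + 1)).filter (fun x => x ≠ i ∧ x ≠ j)

/-- `S_{{i,j}_n^m}` is Laplacian realizable: it is the Laplacian spectrum of some connected
simple graph on `n` vertices. -/
def LaplacianRealizable (n m i j : ℕ) : Prop :=
  ∃ (G : SimpleGraph (Fin n)) (_ : DecidableRel G.Adj),
    G.Connected ∧ laplacianSpectrum G = (specSet n m i j).map (fun x : ℕ => (x : ℝ))

/-! Necessity. The eigenvalue `n` makes the complement disconnected, and the eigenvalue 1 of `G` is
an eigenvalue `n - 1` of the complement. An eigenvalue never exceeds the order of some component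
(`exists_le_card_reachable`), so the complement is a component of order `n - 1` plus an isolated
vertex: `G` is a cone. Deleting the apex lowers the eigenvalues other than 0 and `n` by 1, so the
double eigenvalue 1 leaves at least three components on `n - 1` vertices, while an eigenvalue `n -
1` would leave one of order at least `n - 2`. Hence `n - 1` is not an eigenvalue, and `j = n - 1`.
The trace is twice the number of edges, which fixes the parity of `i`.

Sufficiency. It remains to realize the base of the cone, with eigenvalues 0, 0, 0 and `1, …, n - 3`
without `i - 1`. Isolated vertices reduce this to the spectra `{0, …, c} ∖ {p}`, which
`IsIntervalSpectrum.of_parity` builds from one or two vertices by complements, cones and disjoint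
unions with an edge; the case `i = n - 2` uses an edge and one isolated vertex instead. -/

open Polynomial

/-! ### Characteristic polynomials of complements and disjoint unions. -/

section Construction

variable {V W : Type*} [Fintype V] [DecidableEq V] [Fintype W] [DecidableEq W]

theorem lapMatrix_mulVec_apply_eq_sum (G : SimpleGraph V) [DecidableRel G.Adj] (x : V → ℝ) (a : V) :
    (G.lapMatrix ℝ).mulVec x a = ∑ w, if G.Adj a w then x a - x w else 0 := by
  rw [SimpleGraph.lapMatrix_mulVec_apply, SimpleGraph.degree_eq_sum_if_adj, Finset.sum_mul,
    SimpleGraph.neighborFinset_eq_filter, Finset.sum_filter, ← Finset.sum_sub_distrib]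
  exact Finset.sum_congr rfl fun w _ => by split_ifs <;> simp

theorem lapMatrix_compl_mulVec_apply (G : SimpleGraph V) [DecidableRel G.Adj]
    [DecidableRel Gᶜ.Adj] (x : V → ℝ) (a : V) :
    (Gᶜ.lapMatrix ℝ).mulVec x a
      = Fintype.card V * x a - ∑ w, x w - (G.lapMatrix ℝ).mulVec x a := by
  have h : (Fintype.card V : ℝ) * x a - ∑ w, x w = ∑ w, (x a - x w) := by
    rw [Finset.sum_sub_distrib, Finset.sum_const, nsmul_eq_mul, Finset.card_univ]
  rw [h, lapMatrix_mulVec_apply_eq_sum, lapMatrix_mulVec_apply_eq_sum, ← Finset.sum_sub_distrib]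
  refine Finset.sum_congr rfl fun w _ => ?_
  by_cases hw : a = w
  · subst hw; simp
  · by_cases hG : G.Adj a w <;> simp [SimpleGraph.compl_adj, hw, hG]

theorem lapMatrix_compl (G : SimpleGraph V) [DecidableRel G.Adj] [DecidableRel Gᶜ.Adj] :
    Gᶜ.lapMatrix ℝ
      = (Fintype.card V : ℝ) • (1 : Matrix V V ℝ) - Matrix.of (fun _ _ => 1) - G.lapMatrix ℝ := by
  refine Matrix.ext_of_mulVec_single fun b => ?_
  ext a
  rw [lapMatrix_compl_mulVec_apply]
  simp only [Matrix.sub_mulVec, Matrix.smul_mulVec, Matrix.one_mulVec, Pi.sub_apply, Pi.smul_apply,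
    smul_eq_mul]
  congr 2
  simp

theorem lapMatrix_mul_ones (G : SimpleGraph V) [DecidableRel G.Adj] :
    G.lapMatrix ℝ * Matrix.of (fun _ _ => 1) = (0 : Matrix V V ℝ) := by
  ext a b
  have := congrFun (G.lapMatrix_mulVec_const_eq_zero (R := ℝ)) a
  simpa [Matrix.mul_apply, Matrix.mulVec, dotProduct] using this

theorem det_one_add_smul_ones (t : ℝ) :
    (1 + t • Matrix.of (fun _ _ => 1) : Matrix V V ℝ).det = 1 + t * Fintype.card V := by
  have := Matrix.det_one_add_replicateCol_mul_replicateRow (ι := Unit)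
    (fun _ : V => t) (fun _ : V => (1 : ℝ))
  have h : Matrix.replicateCol Unit (fun _ : V => t) * Matrix.replicateRow Unit (fun _ : V => (1 : ℝ))
      = t • (Matrix.of (fun _ _ => 1) : Matrix V V ℝ) := by
    ext a b; simp [Matrix.mul_apply]
  rw [h] at this
  rw [this]
  simp [dotProduct, mul_comm]

/-- With `L` the Laplacian of `G`, `J` the all-ones matrix and `y = x - n`, the relation `L * J = 0`
factors `x - (n - J - L)` as `(L + y) * (1 + y⁻¹ J)`, and the second determinant is `x / y`. -/
theorem eval_charpoly_lapMatrix_compl (G : SimpleGraph V) [DecidableRel G.Adj]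
    [DecidableRel Gᶜ.Adj] (x : ℝ) (hx : x - Fintype.card V ≠ 0) :
    (x - Fintype.card V) * (Gᶜ.lapMatrix ℝ).charpoly.eval x
      = x * ((-1) ^ Fintype.card V * (G.lapMatrix ℝ).charpoly.eval (Fintype.card V - x)) := by
  set n : ℝ := (Fintype.card V : ℝ)
  set y := x - n with hy
  set J : Matrix V V ℝ := Matrix.of (fun _ _ => 1)
  have h1 : Matrix.scalar V x - Gᶜ.lapMatrix ℝ
      = (G.lapMatrix ℝ + y • (1 : Matrix V V ℝ)) * (1 + y⁻¹ • J) := by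
    rw [lapMatrix_compl, Matrix.mul_add, Matrix.mul_one, Matrix.mul_smul, Matrix.add_mul,
      lapMatrix_mul_ones, zero_add, Matrix.smul_mul, Matrix.one_mul, smul_smul,
      inv_mul_cancel₀ hx, one_smul, hy, sub_smul, Matrix.scalar_apply,
      ← Matrix.smul_one_eq_diagonal]
    abel
  have h2 : Matrix.scalar V (n - x) - G.lapMatrix ℝ
      = -(G.lapMatrix ℝ + y • (1 : Matrix V V ℝ)) := by
    rw [hy, sub_smul, Matrix.scalar_apply, ← Matrix.smul_one_eq_diagonal, sub_smul]
    abel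
  rw [Matrix.eval_charpoly, Matrix.eval_charpoly, h1, h2, Matrix.det_mul, Matrix.det_neg,
    det_one_add_smul_ones, ← mul_assoc ((-1 : ℝ) ^ _), ← mul_pow]
  have h3 : x = y + n := by rw [hy]; ring
  rw [h3]
  field_simp
  norm_num
  exact Or.inl rfl

theorem charpoly_lapMatrix_compl (G : SimpleGraph V) [DecidableRel G.Adj] [DecidableRel Gᶜ.Adj]
    (S : Multiset ℝ) (h : (G.lapMatrix ℝ).charpoly = ((0 ::ₘ S).map fun s => X - C s).prod) :
    (Gᶜ.lapMatrix ℝ).charpoly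
      = ((0 ::ₘ S.map fun s : ℝ => (Fintype.card V : ℝ) - s).map fun s => X - C s).prod := by
  have hcard : Fintype.card V = S.card + 1 := by
    have := congrArg natDegree h
    rwa [Matrix.charpoly_natDegree_eq_dim, natDegree_multiset_prod_X_sub_C_eq_card,
      Multiset.card_cons] at this
  set n : ℝ := (Fintype.card V : ℝ)
  -- The evaluated identity needs `x ≠ n`; agreement off one point suffices for polynomials.
  refine eq_of_infinite_eval_eq _ _ (Set.Infinite.mono (s := {n}ᶜ) ?_
    (Set.Finite.infinite_compl (Set.finite_singleton n)))
  intro x hx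
  have hx' : x - n ≠ 0 := sub_ne_zero.2 hx
  refine mul_left_cancel₀ hx' ?_
  rw [eval_charpoly_lapMatrix_compl G x hx', h, hcard]
  simp only [Multiset.map_cons, Multiset.prod_cons, Multiset.map_map, eval_mul, eval_sub, eval_X,
    eval_C, eval_multiset_prod, Function.comp_def, sub_zero, pow_succ]
  have h3 : (S.map fun s => x - (n - s)).prod = (-1) ^ S.card * (S.map fun s => n - x - s).prod := by
    have := Multiset.prod_map_neg (S.map fun s => n - x - s)
    rw [Multiset.card_map, Multiset.map_map] at this
    rw [← this]
    congr 1
    exact Multiset.map_congr rfl fun s _ => by simp only [Function.comp_apply]; ring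
  rw [h3, ← hcard]
  ring

theorem lapMatrix_sum (G : SimpleGraph V) (H : SimpleGraph W) [DecidableRel G.Adj]
    [DecidableRel H.Adj] [DecidableRel (G.sum H).Adj] :
    (G.sum H).lapMatrix ℝ = Matrix.fromBlocks (G.lapMatrix ℝ) 0 0 (H.lapMatrix ℝ) := by
  refine Matrix.ext_of_mulVec_single fun b => ?_
  ext a
  rw [lapMatrix_mulVec_apply_eq_sum, Fintype.sum_sum_type, Matrix.mulVec_single_one,
    Matrix.col_apply]
  rcases b with b | b <;> rcases a with a | a
  · have := lapMatrix_mulVec_apply_eq_sum G (Pi.single b 1) a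
    rw [Matrix.mulVec_single_one, Matrix.col_apply] at this
    simp [this, Pi.single_apply]
  · simp
  · simp
  · have := lapMatrix_mulVec_apply_eq_sum H (Pi.single b 1) a
    rw [Matrix.mulVec_single_one, Matrix.col_apply] at this
    simp [this, Pi.single_apply]

theorem charpoly_lapMatrix_sum (G : SimpleGraph V) (H : SimpleGraph W) [DecidableRel G.Adj]
    [DecidableRel H.Adj] [DecidableRel (G.sum H).Adj] :
    ((G.sum H).lapMatrix ℝ).charpoly
      = (G.lapMatrix ℝ).charpoly * (H.lapMatrix ℝ).charpoly := by
  rw [lapMatrix_sum, Matrix.charpoly_fromBlocks_zero₁₂]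

theorem charpoly_lapMatrix_comap (e : V ≃ W) (G : SimpleGraph V) [DecidableRel G.Adj]
    [DecidableRel (G.comap e.symm).Adj] :
    ((G.comap e.symm).lapMatrix ℝ).charpoly = (G.lapMatrix ℝ).charpoly := by
  rw [← Matrix.charpoly_reindex e]
  congr 1
  refine Matrix.ext_of_mulVec_single fun b => ?_
  ext a
  have := lapMatrix_mulVec_apply_eq_sum G (Pi.single (e.symm b) 1) (e.symm a)
  rw [Matrix.mulVec_single_one, Matrix.col_apply] at this
  rw [lapMatrix_mulVec_apply_eq_sum, Matrix.mulVec_single_one, Matrix.col_apply,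
    Matrix.reindex_apply, Matrix.submatrix_apply, this, ← e.symm.sum_comp]
  simp [Pi.single_apply]

omit [Fintype V] [DecidableEq V] [Fintype W] [DecidableEq W] in
theorem connected_compl_sum [Nonempty V] [Nonempty W] (G : SimpleGraph V) (H : SimpleGraph W) :
    (G.sum H)ᶜ.Connected := by
  have hlr (v : V) (w : W) : (G.sum H)ᶜ.Adj (.inl v) (.inr w) := by
    simp [SimpleGraph.compl_adj]
  obtain ⟨v₀⟩ := ‹Nonempty V›
  obtain ⟨w₀⟩ := ‹Nonempty W›
  refine SimpleGraph.connected_iff_exists_forall_reachable _ |>.2 ⟨.inl v₀, ?_⟩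
  rintro (v | w)
  · exact (hlr v₀ w₀).reachable.trans (hlr v w₀).symm.reachable
  · exact (hlr v₀ w).reachable

end Construction

/-! ### Operations on integral Laplacian spectra. -/

/-- Some simple graph on `n` vertices has the Laplacian eigenvalues `S`. -/
def IsLaplacianSpectrum (n : ℕ) (S : Multiset ℕ) : Prop :=
  ∃ (G : SimpleGraph (Fin n)) (_ : DecidableRel G.Adj),
    (G.lapMatrix ℝ).charpoly = (S.map fun s : ℕ => X - C (s : ℝ)).prod

namespace IsLaplacianSpectrum

theorem compl {n : ℕ} {S : Multiset ℕ} (h : IsLaplacianSpectrum n (0 ::ₘ S))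
    (hS : ∀ s ∈ S, s ≤ n) : IsLaplacianSpectrum n (0 ::ₘ S.map fun s => n - s) := by
  classical
  obtain ⟨G, _, hG⟩ := h
  refine ⟨Gᶜ, inferInstance, ?_⟩
  rw [charpoly_lapMatrix_compl G (S.map fun s : ℕ => (s : ℝ))
    (by rw [hG]; simp [Multiset.map_map])]
  simp only [Multiset.map_cons, Multiset.map_map, Function.comp_def, Nat.cast_zero,
    Fintype.card_fin]
  congr 2
  exact Multiset.map_congr rfl fun s hs => by rw [Nat.cast_sub (hS s hs)]

theorem add {m n : ℕ} {S T : Multiset ℕ} (hS : IsLaplacianSpectrum m S)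
    (hT : IsLaplacianSpectrum n T) : IsLaplacianSpectrum (m + n) (S + T) := by
  classical
  obtain ⟨G, _, hG⟩ := hS
  obtain ⟨H, _, hH⟩ := hT
  refine ⟨(G.sum H).comap finSumFinEquiv.symm, inferInstance, ?_⟩
  rw [charpoly_lapMatrix_comap, charpoly_lapMatrix_sum, hG, hH, Multiset.map_add,
    Multiset.prod_add]

theorem singleton_zero : IsLaplacianSpectrum 1 {0} := by
  refine ⟨⊥, inferInstance, ?_⟩
  have : (⊥ : SimpleGraph (Fin 1)).lapMatrix ℝ = 0 := by
    ext a b; simp [SimpleGraph.lapMatrix, SimpleGraph.degMatrix]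
  rw [this]
  simp

theorem cons_zero {n : ℕ} {S : Multiset ℕ} (h : IsLaplacianSpectrum n S) :
    IsLaplacianSpectrum (n + 1) (0 ::ₘ S) := by
  have := h.add singleton_zero
  rwa [add_comm S, Multiset.singleton_add] at this

theorem pair_zero_two : IsLaplacianSpectrum 2 {0, 2} := by
  have := (singleton_zero.cons_zero).compl (by simp)
  simpa using this

/-- Joining a new vertex to a graph. -/
theorem exists_connected_join {n : ℕ} {S : Multiset ℕ} (h : IsLaplacianSpectrum n (0 ::ₘ S))
    (hn : n ≠ 0) (hS : ∀ s ∈ S, s ≤ n) :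
    ∃ (G : SimpleGraph (Fin (n + 1))) (_ : DecidableRel G.Adj), G.Connected ∧
      (G.lapMatrix ℝ).charpoly
        = ((0 ::ₘ (n + 1) ::ₘ S.map fun s => s + 1).map fun s : ℕ => X - C (s : ℝ)).prod := by
  classical
  obtain ⟨H, _, hH⟩ := h.compl hS
  obtain ⟨K, _, hK⟩ := singleton_zero
  have : Nonempty (Fin n) := Fin.pos_iff_nonempty.1 (Nat.pos_of_ne_zero hn)
  refine ⟨(H.sum K)ᶜ.comap finSumFinEquiv.symm, inferInstance, ?_, ?_⟩
  · exact (SimpleGraph.Iso.comap finSumFinEquiv.symm (H.sum K)ᶜ).connected_iff.2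
      (connected_compl_sum H K)
  -- The join is the complement of a disjoint union: its second zero becomes `n + 1`, and each `n -
  -- s` becomes `s + 1`.
  · rw [charpoly_lapMatrix_comap, charpoly_lapMatrix_compl (H.sum K)
      (0 ::ₘ S.map fun s : ℕ => ((n - s : ℕ) : ℝ))]
    · simp only [Multiset.map_cons, Multiset.map_map, Function.comp_def, Fintype.card_sum,
        Fintype.card_fin, Nat.cast_zero, sub_zero, Nat.cast_add, Nat.cast_one]
      congr 3
      refine Multiset.map_congr rfl fun s hs => ?_
      rw [Nat.cast_sub (hS s hs)]
      congr 2
      ring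
    · rw [charpoly_lapMatrix_sum, hH, hK]
      simp [Multiset.map_map, mul_comm]

theorem join {n : ℕ} {S : Multiset ℕ} (h : IsLaplacianSpectrum n (0 ::ₘ S)) (hn : n ≠ 0)
    (hS : ∀ s ∈ S, s ≤ n) :
    IsLaplacianSpectrum (n + 1) (0 ::ₘ (n + 1) ::ₘ S.map fun s => s + 1) := by
  obtain ⟨G, hd, -, hG⟩ := h.exists_connected_join hn hS
  exact ⟨G, hd, hG⟩

end IsLaplacianSpectrum

/-! ### The spectra `{0, …, c} ∖ {p}`. -/

theorem insert_two_erase (c : ℕ) (hc : 2 ≤ c) :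
    2 ::ₘ ((Finset.Icc 1 c).erase 2).val = (Finset.Icc 1 c).val := by
  rw [← Finset.insert_val_of_notMem (Finset.notMem_erase 2 _),
    Finset.insert_erase (Finset.mem_Icc.2 ⟨by omega, hc⟩)]

/-- `{0, …, c} ∖ {p}` is a Laplacian spectrum. -/
def IsIntervalSpectrum (p c : ℕ) : Prop :=
  IsLaplacianSpectrum c (0 ::ₘ ((Finset.Icc 1 c).erase p).val)

namespace IsIntervalSpectrum

theorem one_one : IsIntervalSpectrum 1 1 := by
  simpa [IsIntervalSpectrum] using IsLaplacianSpectrum.singleton_zero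

theorem one_two : IsIntervalSpectrum 1 2 :=
  IsLaplacianSpectrum.pair_zero_two

/-- Add an isolated vertex, then a dominating one: the nonzero eigenvalues shift by 1, the extra 0
becomes 1, and `c + 2` appears. -/
theorem succ_add_two {p c : ℕ} (h : IsIntervalSpectrum p c) (hp : 1 ≤ p) (hpc : p ≤ c) :
    IsIntervalSpectrum (p + 1) (c + 2) := by
  have h1 := h.cons_zero.join (by omega) (by
    simp only [Multiset.mem_cons, Finset.mem_val, Finset.mem_erase, Finset.mem_Icc]
    omega)
  have h2 : (c + 1 + 1) ::ₘ (0 ::ₘ ((Finset.Icc 1 c).erase p).val).map (fun s => s + 1)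
      = ((Finset.Icc 1 (c + 2)).erase (p + 1)).val := by
    refine (Multiset.Nodup.ext ?_ (Finset.nodup _)).2 fun a => ?_
    · refine Multiset.nodup_cons.2 ⟨?_, Multiset.Nodup.map (add_left_injective 1)
        (Multiset.nodup_cons.2 ⟨by simp [-Finset.erase_val], Finset.nodup _⟩)⟩
      simp only [Multiset.mem_map, Multiset.mem_cons, Finset.mem_val, Finset.mem_erase,
        Finset.mem_Icc]
      omega
    · simp only [Multiset.mem_map, Multiset.mem_cons, Finset.mem_val, Finset.mem_erase,
        Finset.mem_Icc]
      constructor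
      · rintro (rfl | ⟨b, hb, rfl⟩) <;> omega
      · intro ha
        by_cases hac : a = c + 2
        · exact Or.inl hac
        · exact Or.inr ⟨a - 1, by omega, by omega⟩
  rw [h2] at h1
  exact h1

/-- The complement of the disjoint union with an edge. -/
theorem pair_add {c : ℕ} (h : IsIntervalSpectrum 2 c) (hc : 2 ≤ c) :
    IsLaplacianSpectrum (c + 2) (0 ::ₘ 0 ::ₘ (Finset.Icc 1 c).val) := by
  have := h.add IsLaplacianSpectrum.pair_zero_two
  rw [← insert_two_erase c hc]
  convert this using 1
  simp only [Multiset.insert_eq_cons, ← Multiset.singleton_add]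
  abel

/-- The edge in `pair_add` supplies the missing eigenvalue 2; complementing then sends `0, 1, …, c`
to `c + 2, c + 1, …, 2`. -/
theorem one_add_two {c : ℕ} (h : IsIntervalSpectrum 2 c) (hc : 2 ≤ c) :
    IsIntervalSpectrum 1 (c + 2) := by
  have h1 := (h.pair_add hc).compl (by
    simp only [Multiset.mem_cons, Finset.mem_val, Finset.mem_Icc]
    omega)
  have h2 : (0 ::ₘ (Finset.Icc 1 c).val).map (fun s => c + 2 - s)
      = ((Finset.Icc 1 (c + 2)).erase 1).val := by
    refine (Multiset.Nodup.ext ?_ (Finset.nodup _)).2 fun a => ?_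
    · refine Multiset.Nodup.map_on ?_ (Multiset.nodup_cons.2 ⟨by simp [-Finset.erase_val], Finset.nodup _⟩)
      simp only [Multiset.mem_cons, Finset.mem_val, Finset.mem_Icc]
      omega
    · simp only [Multiset.mem_map, Multiset.mem_cons, Finset.mem_val, Finset.mem_erase,
        Finset.mem_Icc]
      constructor
      · rintro ⟨b, hb, rfl⟩; omega
      · intro ha; exact ⟨c + 2 - a, by omega, by omega⟩
  rw [h2] at h1
  exact h1

/-- Add an isolated vertex and complement: `0, 2, …, c` becomes `c + 1, c - 1, …, 1`. -/
theorem self_succ {c : ℕ} (h : IsIntervalSpectrum 1 c) : IsIntervalSpectrum c (c + 1) := by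
  have h1 := h.cons_zero.compl (by
    simp only [Multiset.mem_cons, Finset.mem_val, Finset.mem_erase, Finset.mem_Icc]
    omega)
  have h2 : (0 ::ₘ ((Finset.Icc 1 c).erase 1).val).map (fun s => c + 1 - s)
      = ((Finset.Icc 1 (c + 1)).erase c).val := by
    refine (Multiset.Nodup.ext ?_ (Finset.nodup _)).2 fun a => ?_
    · refine Multiset.Nodup.map_on ?_ (Multiset.nodup_cons.2 ⟨by simp [-Finset.erase_val], Finset.nodup _⟩)
      simp only [Multiset.mem_cons, Finset.mem_val, Finset.mem_erase, Finset.mem_Icc]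
      omega
    · simp only [Multiset.mem_map, Multiset.mem_cons, Finset.mem_val, Finset.mem_erase,
        Finset.mem_Icc]
      constructor
      · rintro ⟨b, hb, rfl⟩; omega
      · intro ha; exact ⟨c + 1 - a, by omega, by omega⟩
  rw [h2] at h1
  exact h1

/-- Strong induction on `c`: `p = 1` comes from `one_add_two`, `p = c - 1` from `self_succ`, and the
rest from `succ_add_two`. The parity condition is the one forced by the trace, and each move
preserves it. -/
theorem of_parity (c p : ℕ) (hp : 1 ≤ p) (hpc : p + 1 ≤ c ∨ c = 1 ∧ p = 1)
    (h : (c % 4 = 0 ∨ c % 4 = 3) ∧ p % 2 = 0 ∨ (c % 4 = 1 ∨ c % 4 = 2) ∧ p % 2 = 1) :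
    IsIntervalSpectrum p c := by
  induction c using Nat.strong_induction_on generalizing p with
  | _ c ih =>
    rcases hpc with hpc | ⟨rfl, rfl⟩
    swap
    · exact one_one
    by_cases hc2 : c = 2
    · obtain rfl : p = 1 := by omega
      subst hc2
      exact one_two
    by_cases hp1 : p = 1
    · obtain ⟨d, rfl⟩ : ∃ d, c = d + 2 := ⟨c - 2, by omega⟩
      subst hp1
      exact (ih d (by omega) 2 (by omega) (by omega) (by omega)).one_add_two (by omega)
    -- The pair `c = 3`, `p = 2` goes to `succ_add_two`, starting from the degenerate pair `c = p =
    -- 1`.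
    by_cases hpc1 : c = p + 1 ∧ c ≠ 3
    · obtain ⟨rfl, -⟩ := hpc1
      exact (ih p (by omega) 1 (by omega) (by omega) (by omega)).self_succ
    · obtain ⟨d, rfl⟩ : ∃ d, c = d + 2 := ⟨c - 2, by omega⟩
      obtain ⟨q, rfl⟩ : ∃ q, p = q + 1 := ⟨p - 1, by omega⟩
      exact (ih d (by omega) q (by omega) (by omega) (by omega)).succ_add_two (by omega)
        (by omega)

end IsIntervalSpectrum

/-! ### Sufficiency: the realizing cone. -/

theorem specSet_one {n i j : ℕ} (hi : i ≠ 1) (hj : j ≠ 1) :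
    specSet n 1 i j = 1 ::ₘ ((Finset.range (n + 1)).filter fun x => x ≠ i ∧ x ≠ j).val := by
  rw [specSet, Multiset.filter_cons_of_pos _ ⟨hi.symm, hj.symm⟩]
  rfl

theorem laplacianRealizable_of_isLaplacianSpectrum {n i : ℕ} (hn : 4 ≤ n) (hi : 2 ≤ i)
    (hin : i + 2 ≤ n)
    (h : IsLaplacianSpectrum (n - 1) (0 ::ₘ 0 ::ₘ 0 ::ₘ ((Finset.Icc 1 (n - 3)).erase (i - 1)).val)) :
    LaplacianRealizable n 1 i (n - 1) := by
  obtain ⟨m, rfl⟩ : ∃ m, n = m + 1 := ⟨n - 1, by omega⟩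
  rw [Nat.add_sub_cancel] at h ⊢
  obtain ⟨G, hd, hG, hS⟩ := h.exists_connected_join (by omega) (by
    simp only [Multiset.mem_cons, Finset.mem_val, Finset.mem_erase, Finset.mem_Icc]
    omega)
  refine ⟨G, hd, hG, ?_⟩
  have key : specSet (m + 1) 1 i m = 0 ::ₘ (m + 1) ::ₘ (0 ::ₘ 0 ::ₘ
      ((Finset.Icc 1 (m + 1 - 3)).erase (i - 1)).val).map (fun s => s + 1) := by
    rw [specSet_one (by omega) (by omega), Multiset.map_cons, Multiset.cons_swap (m + 1),
      Multiset.cons_swap 0]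
    congr 1
    symm
    refine (Multiset.Nodup.ext ?_ (Finset.nodup _)).2 fun a => ?_
    · have h1 : ((0 ::ₘ ((Finset.Icc 1 (m + 1 - 3)).erase (i - 1)).val).map
          (fun s => s + 1)).Nodup := Multiset.Nodup.map (add_left_injective 1)
        (Multiset.nodup_cons.2 ⟨by simp [-Finset.erase_val], Finset.nodup _⟩)
      refine Multiset.nodup_cons.2 ⟨by simp, Multiset.nodup_cons.2 ⟨?_, h1⟩⟩
      simp only [Multiset.mem_map, Multiset.mem_cons, Finset.mem_val, Finset.mem_erase,
        Finset.mem_Icc]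
      omega
    · simp only [Multiset.mem_map, Multiset.mem_cons, Finset.mem_val, Finset.mem_erase,
        Finset.mem_Icc, Finset.mem_filter, Finset.mem_range]
      constructor
      · rintro (rfl | rfl | ⟨b, hb, rfl⟩) <;> omega
      · intro ha
        by_cases h0 : a = 0
        · exact Or.inl h0
        · by_cases hm : a = m + 1
          · exact Or.inr (Or.inl hm)
          · exact Or.inr (Or.inr ⟨a - 1, by omega, by omega⟩)
  rw [laplacianSpectrum, hS, key]
  have := roots_multiset_prod_X_sub_C ((0 ::ₘ (m + 1) ::ₘ (0 ::ₘ 0 ::ₘ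
      ((Finset.Icc 1 (m + 1 - 3)).erase (i - 1)).val).map (fun s => s + 1)).map
        (fun x : ℕ => (x : ℝ)))
  rwa [Multiset.map_map] at this

theorem laplacianRealizable_of_parity {n i : ℕ} (hn : 6 ≤ n) (hi : 2 ≤ i) (hin : i + 2 ≤ n)
    (h : (n % 4 = 0 ∨ n % 4 = 1) ∧ i % 2 = 0 ∨ (n % 4 = 2 ∨ n % 4 = 3) ∧ i % 2 = 1) :
    LaplacianRealizable n 1 i (n - 1) := by
  refine laplacianRealizable_of_isLaplacianSpectrum (by omega) hi hin ?_
  by_cases hin' : i + 3 ≤ n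
  · have := (IsIntervalSpectrum.of_parity (n - 3) (i - 1) (by omega) (by omega)
      (by omega)).cons_zero.cons_zero
    rwa [show n - 3 + 1 + 1 = n - 1 by omega] at this
  -- Here `i - 1 = n - 3` is the top of the interval, so the base needs `0, 0, 0, 1, …, n - 4`.
  · obtain rfl : n = i + 2 := by omega
    have := ((IsIntervalSpectrum.of_parity (i - 2) 2 (by omega) (by omega) (by omega)).pair_add
      (by omega)).cons_zero
    have hT : (Finset.Icc 1 (i + 2 - 3)).erase (i - 1) = Finset.Icc 1 (i - 2) := by
      ext a
      simp only [Finset.mem_erase, Finset.mem_Icc]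
      omega
    rwa [hT, show i + 2 - 1 = i - 2 + 2 + 1 by omega]

/-! ### Necessity: components and dominating vertices. -/

section Necessity

variable {V : Type*} [Fintype V] [DecidableEq V]

theorem sum_eq_zero_of_lapMatrix_mulVec {G : SimpleGraph V} [DecidableRel G.Adj] {x : V → ℝ} {μ : ℝ}
    (hx : (G.lapMatrix ℝ).mulVec x = μ • x) (hμ : μ ≠ 0) : ∑ a, x a = 0 := by
  have h1 : (fun _ : V => (1 : ℝ)) ⬝ᵥ (G.lapMatrix ℝ).mulVec x = 0 := by
    rw [Matrix.dotProduct_mulVec, ← Matrix.mulVec_transpose, (G.isSymm_lapMatrix (R := ℝ)).eq,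
      G.lapMatrix_mulVec_const_eq_zero, zero_dotProduct]
  rw [hx, dotProduct_smul, smul_eq_mul] at h1
  have := (mul_eq_zero.1 h1).resolve_left hμ
  simpa [dotProduct] using this

open Classical in
/-- A Laplacian eigenvalue is at most the order of some connected component. -/
theorem exists_le_card_reachable {H : SimpleGraph V} [DecidableRel H.Adj] {x : V → ℝ} {μ : ℝ}
    (hx : (H.lapMatrix ℝ).mulVec x = μ • x) (hx0 : x ≠ 0) :
    ∃ c, μ ≤ (Finset.univ.filter fun w => H.Reachable c w).card := by
  obtain ⟨c, hc⟩ := Function.ne_iff.1 hx0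
  refine ⟨c, ?_⟩
  set s := Finset.univ.filter fun w => H.Reachable c w with hs
  have hcs : c ∈ s := by simp [hs]
  have hpos : 0 < ∑ a ∈ s, x a ^ 2 :=
    Finset.sum_pos' (fun a _ => sq_nonneg _) ⟨c, hcs, by have : x c ≠ 0 := hc; positivity⟩
  -- `T` is the Laplacian quadratic form of `x` on the component; symmetrizing gives `2T` as a sum
  -- of squares over adjacent ordered pairs, bounded by the sum over all pairs.
  set T := ∑ a ∈ s, ∑ w ∈ s, if H.Adj a w then x a * (x a - x w) else 0 with hT
  have h1 : μ * ∑ a ∈ s, x a ^ 2 = T := by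
    rw [Finset.mul_sum]
    refine Finset.sum_congr rfl fun a ha => ?_
    have h := congrFun hx a
    rw [lapMatrix_mulVec_apply_eq_sum, Pi.smul_apply, smul_eq_mul] at h
    have h2 : μ * x a ^ 2 = x a * (μ * x a) := by ring
    rw [h2, ← h, Finset.mul_sum]
    symm
    refine (Finset.sum_subset (Finset.subset_univ s) fun w _ hw => ?_).trans
      (Finset.sum_congr rfl fun w _ => by rw [mul_ite, mul_zero])
    rw [if_neg]
    intro haw
    exact hw (by
      simp only [hs, Finset.mem_filter, Finset.mem_univ, true_and] at ha ⊢
      exact ha.trans haw.reachable)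
  have h2 : T = ∑ a ∈ s, ∑ w ∈ s, if H.Adj a w then x w * (x w - x a) else 0 := by
    rw [hT, Finset.sum_comm]
    exact Finset.sum_congr rfl fun a _ => Finset.sum_congr rfl fun w _ => by
      simp only [H.adj_comm w a]
  have h3 : T + T ≤ ∑ a ∈ s, ∑ w ∈ s, (x a - x w) ^ 2 := by
    nth_rewrite 2 [h2]
    rw [hT, ← Finset.sum_add_distrib]
    refine Finset.sum_le_sum fun a _ => ?_
    rw [← Finset.sum_add_distrib]
    refine Finset.sum_le_sum fun w _ => ?_
    split_ifs
    · exact le_of_eq (by ring)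
    · simpa using sq_nonneg (x a - x w)
  have h4 : ∑ a ∈ s, ∑ w ∈ s, (x a - x w) ^ 2
      = 2 * (s.card * ∑ a ∈ s, x a ^ 2) - 2 * (∑ a ∈ s, x a) ^ 2 := by
    have h5 (a w : V) : (x a - x w) ^ 2 = x a ^ 2 - 2 * (x a * x w) + x w ^ 2 := by ring
    simp_rw [h5, Finset.sum_add_distrib, Finset.sum_sub_distrib, Finset.sum_const,
      ← Finset.mul_sum, ← Finset.sum_mul, nsmul_eq_mul, ← Finset.mul_sum]
    ring
  refine le_of_mul_le_mul_right ?_ hpos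
  nlinarith [sq_nonneg (∑ a ∈ s, x a)]

/-- The graph `G` with all edges at `v` removed. -/
def isolateVertex (G : SimpleGraph V) (v : V) : SimpleGraph V where
  Adj a b := G.Adj a b ∧ a ≠ v ∧ b ≠ v
  symm := ⟨fun _ _ h => ⟨h.1.symm, h.2.2, h.2.1⟩⟩
  loopless := ⟨fun _ h => G.loopless.irrefl _ h.1⟩

instance (G : SimpleGraph V) (v : V) [DecidableRel G.Adj] : DecidableRel (isolateVertex G v).Adj :=
  fun a b => inferInstanceAs (Decidable (G.Adj a b ∧ a ≠ v ∧ b ≠ v))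

/-- Row `v` of the eigenvalue equation reads `n * x v - ∑ x = μ * x v`. -/
theorem eigenvector_apply_dominating {G : SimpleGraph V} [DecidableRel G.Adj] {v : V}
    (hv : ∀ a, a ≠ v → G.Adj v a) {x : V → ℝ} {μ : ℝ}
    (hx : (G.lapMatrix ℝ).mulVec x = μ • x) (hsum : ∑ a, x a = 0)
    (hμ : μ ≠ Fintype.card V) : x v = 0 := by
  have h := congrFun hx v
  have h1 : ∑ w, (if G.Adj v w then x v - x w else 0) = ∑ w, (x v - x w) := by
    refine Finset.sum_congr rfl fun w _ => ?_
    by_cases hw : w = v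
    · subst hw; simp
    · rw [if_pos (hv w hw)]
  rw [lapMatrix_mulVec_apply_eq_sum, h1, Finset.sum_sub_distrib, hsum, Finset.sum_const,
    nsmul_eq_mul, Finset.card_univ, Pi.smul_apply, smul_eq_mul, sub_zero] at h
  have h2 : (μ - Fintype.card V) * x v = 0 := by rw [sub_mul, h, sub_self]
  exact (mul_eq_zero.1 h2).resolve_left (sub_ne_zero.2 hμ)

theorem lapMatrix_isolateVertex_mulVec {G : SimpleGraph V} [DecidableRel G.Adj] {v : V}
    (hv : ∀ a, a ≠ v → G.Adj v a) {x : V → ℝ} {μ : ℝ}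
    (hx : (G.lapMatrix ℝ).mulVec x = μ • x) (hxv : x v = 0) :
    ((isolateVertex G v).lapMatrix ℝ).mulVec x = (μ - 1) • x := by
  ext a
  rw [lapMatrix_mulVec_apply_eq_sum, Pi.smul_apply, smul_eq_mul]
  by_cases ha : a = v
  · subst ha
    simp [isolateVertex, hxv]
  · have h := congrFun hx a
    rw [lapMatrix_mulVec_apply_eq_sum, Pi.smul_apply, smul_eq_mul,
      ← Finset.add_sum_erase _ _ (Finset.mem_univ v), if_pos (hv a ha).symm, hxv, sub_zero] at h
    rw [← Finset.add_sum_erase _ _ (Finset.mem_univ v), if_neg (by simp [isolateVertex]), zero_add,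
      sub_mul, ← h, one_mul, add_sub_cancel_left]
    refine Finset.sum_congr rfl fun w hw => ?_
    simp [isolateVertex, ha, Finset.ne_of_mem_erase hw]

omit [Fintype V] [DecidableEq V] in
theorem not_reachable_isolateVertex {G : SimpleGraph V} {v a : V} (ha : a ≠ v) :
    ¬ (isolateVertex G v).Reachable v a := by
  rintro ⟨p⟩
  cases p with
  | nil => exact ha rfl
  | cons h _ => exact h.2.1 rfl

open Classical in
/-- A graph with a Laplacian eigenvalue equal to its order and with the eigenvalue `1` has a
dominating vertex. -/
theorem exists_dominating {G : SimpleGraph V} [DecidableRel G.Adj] {x y : V → ℝ}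
    (hV : 2 ≤ Fintype.card V)
    (hy : (G.lapMatrix ℝ).mulVec y = (Fintype.card V : ℝ) • y) (hy0 : y ≠ 0)
    (hx : (G.lapMatrix ℝ).mulVec x = (1 : ℝ) • x) (hx0 : x ≠ 0) :
    ∃ v, ∀ a, a ≠ v → G.Adj v a := by
  have hn0 : (Fintype.card V : ℝ) ≠ 0 := by
    have : Fintype.card V ≠ 0 := by omega
    exact_mod_cast this
  have hysum := sum_eq_zero_of_lapMatrix_mulVec hy hn0
  have hxsum := sum_eq_zero_of_lapMatrix_mulVec hx one_ne_zero
  have hcy : (Gᶜ.lapMatrix ℝ).mulVec y = 0 := by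
    ext a
    rw [lapMatrix_compl_mulVec_apply, hysum, hy]
    simp
  have hcx : (Gᶜ.lapMatrix ℝ).mulVec x = ((Fintype.card V : ℝ) - 1) • x := by
    ext a
    rw [lapMatrix_compl_mulVec_apply, hxsum, hx]
    simp [sub_mul]
  obtain ⟨c, hc⟩ := exists_le_card_reachable hcx hx0
  set s := Finset.univ.filter fun w => Gᶜ.Reachable c w with hs
  have hconst := SimpleGraph.lapMatrix_mulVec_eq_zero_iff_forall_reachable Gᶜ |>.1 hcy
  -- Otherwise `y`, constant on the components of the complement, would be constant with sum zero.
  obtain ⟨v, hv⟩ : ∃ v, v ∉ s := by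
    by_contra! hall
    have hall' (a : V) : y a = y c := (hconst c a (by simpa [hs] using hall a)).symm
    simp_rw [hall', Finset.sum_const, nsmul_eq_mul, Finset.card_univ] at hysum
    exact hy0 (funext fun a => by
      rw [hall' a]; exact (mul_eq_zero.1 hysum).resolve_left hn0)
  have hcard : Fintype.card V ≤ s.card + 1 := by
    have : (Fintype.card V : ℝ) ≤ s.card + 1 := by linarith
    exact_mod_cast this
  have hins : insert v s = Finset.univ := by
    refine Finset.eq_univ_of_card _ ?_
    have := Finset.card_insert_of_notMem hv
    have := Finset.card_le_univ (insert v s)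
    omega
  refine ⟨v, fun a ha => ?_⟩
  by_contra hva
  have has : a ∈ s := (Finset.mem_insert.1 (hins ▸ Finset.mem_univ a)).resolve_left ha
  refine hv ?_
  simp only [hs, Finset.mem_filter, Finset.mem_univ, true_and] at has ⊢
  refine has.trans (SimpleGraph.Adj.reachable ?_)
  rw [SimpleGraph.compl_adj]
  exact ⟨ha, fun h => hva h.symm⟩

open Classical in
-- Without the apex `v`, the eigenvector `z` yields a component `s` missing at most one other
-- vertex. Eigenvectors for 1 vanish at `v`, are constant on `s` and sum to zero, so they form a
-- space of dimension at most 1.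
theorem eigenvalue_card_sub_one_absurd {G : SimpleGraph V} [DecidableRel G.Adj]
    {x₁ x₂ y z : V → ℝ} (hV : 4 ≤ Fintype.card V)
    (hy : (G.lapMatrix ℝ).mulVec y = (Fintype.card V : ℝ) • y) (hy0 : y ≠ 0)
    (hx₁ : (G.lapMatrix ℝ).mulVec x₁ = (1 : ℝ) • x₁)
    (hx₂ : (G.lapMatrix ℝ).mulVec x₂ = (1 : ℝ) • x₂)
    (hx : LinearIndependent ℝ ![x₁, x₂])
    (hz : (G.lapMatrix ℝ).mulVec z = ((Fintype.card V : ℝ) - 1) • z) (hz0 : z ≠ 0) : False := by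
  have hV' : (4 : ℝ) ≤ Fintype.card V := by exact_mod_cast hV
  obtain ⟨v, hv⟩ := exists_dominating (by omega) hy hy0 hx₁ (hx.ne_zero 0)
  have hzsum := sum_eq_zero_of_lapMatrix_mulVec hz (by linarith)
  have hz' := lapMatrix_isolateVertex_mulVec hv hz
    (eigenvector_apply_dominating hv hz hzsum (by linarith))
  obtain ⟨c, hc⟩ := exists_le_card_reachable hz' hz0
  set s := Finset.univ.filter fun w => (isolateVertex G v).Reachable c w with hs
  have hcard : Fintype.card V ≤ s.card + 2 := by
    have : (Fintype.card V : ℝ) ≤ s.card + 2 := by linarith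
    exact_mod_cast this
  have hvs : v ∉ s := by
    intro hvs
    simp only [hs, Finset.mem_filter, Finset.mem_univ, true_and] at hvs
    have hsub : s ⊆ {v} := by
      intro a ha
      simp only [hs, Finset.mem_filter, Finset.mem_univ, true_and] at ha
      by_contra hav
      exact not_reachable_isolateVertex (by simpa using hav) (hvs.symm.trans ha)
    have := Finset.card_le_card hsub
    rw [Finset.card_singleton] at this
    omega
  have hcompl : ((insert v s)ᶜ).card ≤ 1 := by
    rw [Finset.card_compl, Finset.card_insert_of_notMem hvs]
    omega
  -- A combination vanishing at `c` vanishes on `s` and at `v`; the zero sum kills the value at the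
  -- possible last vertex.
  have key (α β : ℝ) (h0 : α * x₁ c + β * x₂ c = 0) : α • x₁ + β • x₂ = 0 := by
    set w := α • x₁ + β • x₂ with hw
    have hw1 : (G.lapMatrix ℝ).mulVec w = (1 : ℝ) • w := by
      rw [hw, Matrix.mulVec_add, Matrix.mulVec_smul, Matrix.mulVec_smul, hx₁, hx₂, one_smul,
        one_smul, one_smul]
    have hwsum := sum_eq_zero_of_lapMatrix_mulVec hw1 one_ne_zero
    have hwv := eigenvector_apply_dominating hv hw1 hwsum (by linarith)
    have hw' := lapMatrix_isolateVertex_mulVec hv hw1 hwv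
    rw [sub_self, zero_smul,
      SimpleGraph.lapMatrix_mulVec_eq_zero_iff_forall_reachable] at hw'
    have hws (a : V) (ha : a ∈ insert v s) : w a = 0 := by
      rcases Finset.mem_insert.1 ha with rfl | ha
      · exact hwv
      · rw [← hw' c a (by simpa [hs] using ha)]
        simpa [hw] using h0
    ext a
    by_cases ha : a ∈ insert v s
    · exact hws a ha
    · rw [Finset.sum_eq_single a (fun b _ hba => ?_) (by simp)] at hwsum
      · exact hwsum
      · by_contra hb
        have hb' : b ∈ (insert v s)ᶜ := Finset.mem_compl.2 fun hb' => hb (hws b hb')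
        exact hba (Finset.card_le_one.1 hcompl b hb' a (Finset.mem_compl.2 ha))
  rw [LinearIndependent.pair_iff] at hx
  -- This combination vanishes at `c`, so independence gives `x₁ c = x₂ c = 0`; then `key` kills
  -- `x₁` itself.
  have h1 := hx _ _ (key (x₂ c) (-x₁ c) (by ring))
  have h2 := hx _ _ (key 1 0 (by rw [neg_eq_zero.1 h1.2]; simp [h1.1]))
  exact one_ne_zero h2.1

theorem laplacianSpectrum_eq_map_eigenvalues (G : SimpleGraph V) [DecidableRel G.Adj] :
    laplacianSpectrum G
      = Finset.univ.val.map (G.isHermitian_lapMatrix (R := ℝ)).eigenvalues := by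
  have := (G.isHermitian_lapMatrix (R := ℝ)).roots_charpoly_eq_eigenvalues
  simpa [laplacianSpectrum] using this

theorem not_eigenvalue_card_sub_one {G : SimpleGraph V} [DecidableRel G.Adj]
    (hV : 4 ≤ Fintype.card V) (h1 : 2 ≤ (laplacianSpectrum G).count 1)
    (hn : (Fintype.card V : ℝ) ∈ laplacianSpectrum G) :
    (Fintype.card V : ℝ) - 1 ∉ laplacianSpectrum G := by
  intro hn1
  set hA := G.isHermitian_lapMatrix (R := ℝ)
  rw [laplacianSpectrum_eq_map_eigenvalues] at h1 hn hn1
  obtain ⟨k, -, hk⟩ := Multiset.mem_map.1 hn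
  obtain ⟨l, -, hl⟩ := Multiset.mem_map.1 hn1
  rw [Multiset.count_map] at h1
  obtain ⟨a, ha, b, hb, hab⟩ := Finset.one_lt_card.1
    (show 1 < (Finset.univ.filter fun a => 1 = hA.eigenvalues a).card from h1)
  rw [Finset.mem_filter] at ha hb
  have hne (a : V) : (hA.eigenvectorBasis a : V → ℝ) ≠ 0 := fun h =>
    hA.eigenvectorBasis.orthonormal.ne_zero a (by ext v; exact congrFun h v)
  have hev (a : V) := hA.mulVec_eigenvectorBasis a
  refine eigenvalue_card_sub_one_absurd hV (hk ▸ hev k) (hne k) (ha.2 ▸ hev a) (hb.2 ▸ hev b) ?_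
    (hl ▸ hev l) (hne l)
  have hli := hA.eigenvectorBasis.orthonormal.linearIndependent
  rw [LinearIndependent.pair_iff]
  intro s t hst
  have hpair := hli.comp ![a, b] (by
    intro p q
    fin_cases p <;> fin_cases q <;> simp [hab, hab.symm])
  have hcomp : hA.eigenvectorBasis ∘ ![a, b]
      = ![hA.eigenvectorBasis a, hA.eigenvectorBasis b] := by
    ext p
    fin_cases p <;> rfl
  rw [hcomp, LinearIndependent.pair_iff] at hpair
  exact hpair s t (by
    ext v
    simpa using congrFun hst v)

theorem card_laplacianSpectrum (G : SimpleGraph V) [DecidableRel G.Adj] :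
    (laplacianSpectrum G).card = Fintype.card V := by
  simp [laplacianSpectrum_eq_map_eigenvalues]

theorem zero_mem_laplacianSpectrum [Nonempty V] (G : SimpleGraph V) [DecidableRel G.Adj] :
    0 ∈ laplacianSpectrum G := by
  rw [laplacianSpectrum, Polynomial.mem_roots (Matrix.charpoly_monic _).ne_zero,
    Polynomial.IsRoot, Matrix.eval_charpoly, map_zero, zero_sub, Matrix.det_neg,
    G.det_lapMatrix_eq_zero, mul_zero]

theorem sum_laplacianSpectrum (G : SimpleGraph V) [DecidableRel G.Adj] :
    (laplacianSpectrum G).sum = 2 * (G.edgeFinset.card : ℝ) := by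
  rw [laplacianSpectrum, ← Matrix.trace_eq_sum_roots_charpoly_of_splits
    (G.isHermitian_lapMatrix (R := ℝ)).splits_charpoly, SimpleGraph.lapMatrix, Matrix.trace_sub,
    SimpleGraph.trace_adjMatrix, sub_zero, SimpleGraph.degMatrix, Matrix.trace_diagonal]
  exact_mod_cast G.sum_degrees_eq_twice_card_edges

end Necessity

/-! ### Counting, trace parity and the classification. -/

theorem specSet_add_pair {n i j : ℕ} (hi : 2 ≤ i) (hij : i < j) (hj : j ≤ n) :
    i ::ₘ j ::ₘ specSet n 1 i j = 1 ::ₘ Multiset.range (n + 1) := by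
  rw [specSet_one (by omega) (by omega), Multiset.cons_swap j, Multiset.cons_swap i]
  congr 1
  refine (Multiset.Nodup.ext ?_ (Multiset.nodup_range _)).2 fun a => ?_
  · refine Multiset.nodup_cons.2 ⟨?_, Multiset.nodup_cons.2 ⟨?_, Finset.nodup _⟩⟩
    · simp only [Multiset.mem_cons, Finset.mem_val, Finset.mem_filter]
      omega
    · simp only [Finset.mem_val, Finset.mem_filter]
      omega
  · simp only [Multiset.mem_cons, Finset.mem_val, Finset.mem_filter, Finset.mem_range,
      Multiset.mem_range]
    omega

/-- Deleting 1 removes both of its copies, leaving too few eigenvalues for `n` vertices. -/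
theorem card_specSet_lt {n i j : ℕ} (hn : 1 ≤ n) (hij : i ≠ j) (hin : i ≤ n) (hjn : j ≤ n)
    (h : i = 1 ∨ j = 1) : (specSet n 1 i j).card < n := by
  have h1 : (specSet n 1 i j) = ((Finset.range (n + 1)).filter fun x => x ≠ i ∧ x ≠ j).val := by
    rw [specSet, Multiset.filter_cons_of_neg _ (by omega)]
    rfl
  have h2 : ((Finset.range (n + 1)).filter fun x => x ≠ i ∧ x ≠ j)
      = ((Finset.range (n + 1)).erase j).erase i := by
    ext a
    simp only [Finset.mem_filter, Finset.mem_erase, Finset.mem_range]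
    omega
  rw [h1, h2, Finset.card_val, Finset.card_erase_of_mem, Finset.card_erase_of_mem,
    Finset.card_range]
  · omega
  · simp only [Finset.mem_range]; omega
  · simp only [Finset.mem_erase, Finset.mem_range]; omega

theorem LaplacianRealizable.parity {n i j : ℕ} (hn : 6 ≤ n) (hij : i < j) (hjn : j < n)
    (h : LaplacianRealizable n 1 i j) :
    2 ≤ i ∧ j = n - 1 ∧ (n + 1) * n % 4 = 2 * ((i + j + 1) % 2) := by
  obtain ⟨G, hd, -, hG⟩ := h
  have hcard : (specSet n 1 i j).card = n := by
    have := card_laplacianSpectrum G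
    rwa [hG, Multiset.card_map, Fintype.card_fin] at this
  have hi0 : i ≠ 0 := by
    have : Nonempty (Fin n) := ⟨⟨0, by omega⟩⟩
    have h0 := zero_mem_laplacianSpectrum G
    rw [hG, Multiset.mem_map] at h0
    obtain ⟨a, ha, ha0⟩ := h0
    obtain rfl : a = 0 := by exact_mod_cast ha0
    exact (Multiset.mem_filter.1 ha).2.1.symm
  have h1 : ¬ (i = 1 ∨ j = 1) := fun h1 =>
    (card_specSet_lt (by omega) hij.ne (by omega) (by omega) h1).ne hcard
  have hmem (a : ℕ) (han : a ≤ n) (hai : a ≠ i) (haj : a ≠ j) :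
      (a : ℝ) ∈ laplacianSpectrum G := by
    rw [hG]
    refine Multiset.mem_map_of_mem _ (Multiset.mem_filter.2 ⟨?_, hai, haj⟩)
    exact Multiset.mem_cons_of_mem (Multiset.mem_range.2 (by omega))
  refine ⟨by omega, ?_, ?_⟩
  · by_contra hj
    refine not_eigenvalue_card_sub_one (G := G) (by rw [Fintype.card_fin]; omega) ?_ ?_ ?_
    · have : ((specSet n 1 i j).map fun x : ℕ => (x : ℝ)).count ((1 : ℕ) : ℝ) = 2 := by
        rw [Multiset.count_map_eq_count' _ _ Nat.cast_injective, specSet_one (by omega) (by omega),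
          Multiset.count_cons_self, Multiset.count_eq_one_of_mem (Finset.nodup _)]
        simp only [Finset.mem_val, Finset.mem_filter, Finset.mem_range]
        omega
      rw [hG, ← this, Nat.cast_one]
    · rw [Fintype.card_fin]
      exact hmem n le_rfl (by omega) (by omega)
    · have := hmem (n - 1) (by omega) (by omega) (by omega)
      rwa [Fintype.card_fin, ← Nat.cast_one, ← Nat.cast_sub (by omega)]
  -- The trace gives `i + j + 2|E| = 1 + n(n + 1)/2`; doubling and reducing modulo 4 gives the
  -- congruence.
  · have hs : (specSet n 1 i j).sum = 2 * G.edgeFinset.card := by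
      have := sum_laplacianSpectrum G
      rw [hG, ← Nat.cast_multiset_sum] at this
      exact_mod_cast this
    have hs2 := congrArg Multiset.sum
      (specSet_add_pair (n := n) (i := i) (j := j) (by omega) hij (by omega))
    rw [Multiset.sum_cons, Multiset.sum_cons, Multiset.sum_cons, hs] at hs2
    have hs3 := Finset.sum_range_id_mul_two (n + 1)
    have hs4 : ∑ a ∈ Finset.range (n + 1), a = (Multiset.range (n + 1)).sum := by
      rw [Finset.sum, Finset.range_val, Multiset.map_id']
    rw [hs4, Nat.add_sub_cancel] at hs3
    omega

theorem mul_succ_mod_four (n : ℕ) :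
    (n + 1) * n % 4 = if n % 4 = 0 ∨ n % 4 = 3 then 0 else 2 := by
  rw [Nat.mul_mod, Nat.add_mod]
  have := Nat.mod_lt n (show 0 < 4 by norm_num)
  interval_cases n % 4 <;> rfl

theorem laplacianRealizable_one_iff {n i j : ℕ} (hn : 6 ≤ n) (hij : i < j) (hjn : j < n) :
    LaplacianRealizable n 1 i j ↔ j = n - 1 ∧ 2 ≤ i ∧
      ((n % 4 = 0 ∨ n % 4 = 1) ∧ i % 2 = 0 ∨ (n % 4 = 2 ∨ n % 4 = 3) ∧ i % 2 = 1) := by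
  constructor
  · intro h
    obtain ⟨hi, hj, hp⟩ := h.parity hn hij hjn
    rw [mul_succ_mod_four] at hp
    refine ⟨hj, hi, ?_⟩
    split_ifs at hp <;> omega
  · rintro ⟨rfl, hi, hp⟩
    exact laplacianRealizable_of_parity hn hi (by omega) hp

theorem theorem3p2 (n : ℕ) (hn : 6 ≤ n) (i j : ℕ) (hij : i < j) (hjn : j < n) :
    (n % 4 = 0 → (LaplacianRealizable n 1 i j ↔
      j = n - 1 ∧ ∃ k : ℕ, 1 ≤ k ∧ k ≤ (n - 2) / 2 ∧ i = 2 * k)) ∧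
    (n % 4 = 1 → (LaplacianRealizable n 1 i j ↔
      j = n - 1 ∧ ∃ k : ℕ, 1 ≤ k ∧ k ≤ (n - 3) / 2 ∧ i = 2 * k)) ∧
    (n % 4 = 2 → (LaplacianRealizable n 1 i j ↔
      j = n - 1 ∧ ∃ k : ℕ, 1 ≤ k ∧ k ≤ (n - 4) / 2 ∧ i = 2 * k + 1)) ∧
    (n % 4 = 3 → (LaplacianRealizable n 1 i j ↔
      j = n - 1 ∧ ∃ k : ℕ, 1 ≤ k ∧ k ≤ (n - 3) / 2 ∧ i = 2 * k + 1)) := by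
  rw [laplacianRealizable_one_iff hn hij hjn]
  refine ⟨fun h => ?_, fun h => ?_, fun h => ?_, fun h => ?_⟩ <;>
    -- The upper bound on `k` encodes `i ≤ n - 2`, which follows from `i < j = n - 1`.
    refine and_congr_right fun hj => ⟨fun hi => ⟨i / 2, ?_⟩, ?_⟩
  all_goals omega
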